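/- Let $n \ge 3$ and $k \ge 2$. Let $B(n,k)$ be the book graph with $k$ pages that are $n$-cycles, i.e. the simple graph that is the union of $k$ cycles of length $n$, any two of which have in common exactly one fixed edge and its two ends. For a finite connected graph $G$ and a vertex $s$ of $G$ (the sink), the sandpile group $\mathcal S(G,s)$ is the cokernel $\mathbb Z^{V(G)\setminus\{s\}}/\operatorname{Im}\tilde\Delta_s$ of the integer Laplacian of $G$ with the row and column of $s$ deleted. Then, for every choice of the sink $s$, $$\mathcal S(B(n,k),s)\;\cong\;\mathbb Z_{n-1}^{\,k-2}\;\oplus\;\mathbb Z_{(n-1)(n+k-1)}.$$ Moreover, for $n=4$ the book graph $B(4,k)$ is isomorphic to the Cartesian product $S_{k+1}\,\square\,P_2$ of the star graph on $k+1$ vertices (that is, with $k$ leaves) and the path graph on two vertices. -/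

import Mathlib

/-- The vertices of the book graph with `k` pages that are cycles of length `n`: the two ends
`inl false`, `inl true` of the common edge (the spine), and for each page `i` the `n - 2` remaining
vertices `inr (i, 0), …, inr (i, n - 3)` of that page. -/
abbrev BookVertex (n k : ℕ) : Type := Bool ⊕ (Fin k × Fin (n - 2))

/-- The edges of the book graph, each listed in one orientation: the spine, and on each page the
path `inl false, (i, 0), (i, 1), …, (i, n - 3), inl true`. -/
def bookRel (n k : ℕ) : BookVertex n k → BookVertex n k → Prop
  | Sum.inl a, Sum.inl b => a = false ∧ b = true
  | Sum.inl a, Sum.inr (_, j) => a = false ∧ j.val = 0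
  | Sum.inr (i, j), Sum.inr (i', j') => i = i' ∧ j.val + 1 = j'.val
  | Sum.inr (_, j), Sum.inl b => b = true ∧ j.val + 1 = n - 2

/-- The book graph with `k` pages: `k` cycles of length `n` glued along one common edge. -/
def bookGraph (n k : ℕ) : SimpleGraph (BookVertex n k) :=
  SimpleGraph.fromRel (bookRel n k)

instance bookRelDecidable (n k : ℕ) : DecidableRel (bookRel n k)
  | Sum.inl a, Sum.inl b => inferInstanceAs (Decidable (a = false ∧ b = true))
  | Sum.inl a, Sum.inr (_, j) => inferInstanceAs (Decidable (a = false ∧ j.val = 0))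
  | Sum.inr (i, j), Sum.inr (i', j') =>
      inferInstanceAs (Decidable (i = i' ∧ j.val + 1 = j'.val))
  | Sum.inr (_, j), Sum.inl b => inferInstanceAs (Decidable (b = true ∧ j.val + 1 = n - 2))

instance bookGraphDecidable (n k : ℕ) : DecidableRel (bookGraph n k).Adj := fun u v =>
  inferInstanceAs (Decidable (u ≠ v ∧ (bookRel n k u v ∨ bookRel n k v u)))

/-- The Laplacian of `G` with the row and the column of the sink `s` deleted. -/
def reducedLaplacian {V : Type*} [Fintype V] [DecidableEq V] (G : SimpleGraph V)
    [DecidableRel G.Adj] (s : V) : Matrix {v : V // v ≠ s} {v : V // v ≠ s} ℤ :=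
  (G.lapMatrix ℤ).submatrix Subtype.val Subtype.val

/-- The sandpile group of `G` with sink `s`: the cokernel of the reduced Laplacian over `ℤ`. -/
abbrev SandpileGroup {V : Type*} [Fintype V] [DecidableEq V] (G : SimpleGraph V)
    [DecidableRel G.Adj] (s : V) : Type _ :=
  ({v : V // v ≠ s} → ℤ) ⧸ LinearMap.range (reducedLaplacian G s).mulVecLin

/-! For every sink, the sandpile group is the group of weight-zero vectors modulo the image of the
full Laplacian, so it suffices to find a universal harmonic function normalised to vanish at one
vertex. On a book, a harmonic function vanishing at `inl false` is an arithmetic progression along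
each page. It amounts to slopes g_i and a value t at the other spine end, with m g_i = t (m = n - 1)
and ∑ g_i = -t. In the abelian group so presented, m kills each g_i - g_0, and (m + k) g_0 = ∑ (g_0
- g_i), so m(m + k) kills g_0. The sum relation eliminates g_1, leaving k - 2 differences of order m
and g_0 of order m(m + k). `bookSlope` realises these slopes, and `exists_hom_bookSlope` proves them
universal. -/

/-- A function `f` on the vertices of `G` with values in an abelian group is harmonic if the sum of
its differences to the neighbours vanishes at every vertex. -/
def SimpleGraph.IsHarmonic {V M : Type*} [Fintype V] [AddCommGroup M] (G : SimpleGraph V)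
    [DecidableRel G.Adj] (f : V → M) : Prop :=
  ∀ v, ∑ w ∈ G.neighborFinset v, (f v - f w) = 0

/-! ### Harmonic functions and sandpile groups -/

section Sandpile

variable {V M : Type*} [Fintype V] [DecidableEq V] [AddCommGroup M] (G : SimpleGraph V)
  [DecidableRel G.Adj]

/-- Summation by parts: adjacency is symmetric, so the double sum over adjacent pairs can be
swapped. -/
theorem SimpleGraph.sum_lapMatrix_mulVec_smul (y : V → ℤ) (f : V → M) :
    ∑ v, (G.lapMatrix ℤ).mulVec y v • f v
      = ∑ v, y v • ∑ w ∈ G.neighborFinset v, (f v - f w) := by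
  have hswap : ∑ v, ∑ u ∈ G.neighborFinset v, y u • f v
      = ∑ v, ∑ w ∈ G.neighborFinset v, y v • f w :=
    Finset.sum_comm' (by simp [G.adj_comm])
  simp only [G.lapMatrix_mulVec_apply, sub_smul, Finset.sum_sub_distrib, Finset.sum_smul, hswap,
    smul_sub, Finset.smul_sum, Finset.sum_const, G.card_neighborFinset_eq_degree]
  congr 1
  refine Finset.sum_congr rfl fun v _ => ?_
  rw [mul_smul, Nat.cast_smul_eq_nsmul]
  exact smul_comm _ _ _

theorem SimpleGraph.lapMatrix_mulVec_single (v : V) :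
    (G.lapMatrix ℤ).mulVec (Pi.single v 1)
      = ∑ w ∈ G.neighborFinset v, (Pi.single v 1 - Pi.single w 1 : V → ℤ) := by
  have h := G.sum_lapMatrix_mulVec_smul (Pi.single v 1) (fun u => (Pi.single u 1 : V → ℤ))
  rw [← pi_eq_sum_univ'] at h
  rw [h, Finset.sum_eq_single v]
  · simp
  · intro b _ hb
    simp [hb]
  · simp

/-- Sending a vertex to its class modulo the image of the Laplacian is harmonic. -/
theorem SimpleGraph.isHarmonic_mk_single :
    G.IsHarmonic fun v => (LinearMap.range (G.lapMatrix ℤ).mulVecLin).mkQ (Pi.single v 1) := by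
  intro v
  simp only [← map_sub, ← map_sum]
  rw [← G.lapMatrix_mulVec_single v]
  exact (Submodule.Quotient.mk_eq_zero _).2 ⟨_, rfl⟩

theorem SimpleGraph.sum_lapMatrix_mulVec (y : V → ℤ) : ∑ v, (G.lapMatrix ℤ).mulVec y v = 0 := by
  simpa using G.sum_lapMatrix_mulVec_smul y (fun _ => (1 : ℤ))

theorem reducedLaplacian_mulVec (s : V) (y : V → ℤ) (hy : y s = 0) (v : {v : V // v ≠ s}) :
    (reducedLaplacian G s).mulVec (fun w => y w) v = (G.lapMatrix ℤ).mulVec y v := by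
  simp only [Matrix.mulVec, dotProduct, reducedLaplacian, Matrix.submatrix_apply]
  rw [Fintype.sum_eq_add_sum_subtype_ne _ s, hy, mul_zero, zero_add]

/-- A harmonic function whose integral combinations of total weight zero fill `M`, and vanish only
on the image of the Laplacian, identifies every sandpile group of `G` with `M`. -/
theorem SimpleGraph.IsHarmonic.nonempty_sandpileGroup_addEquiv {G : SimpleGraph V}
    [DecidableRel G.Adj] {f : V → M} (hf : G.IsHarmonic f)
    (hsurj : ∀ a, ∃ x : V → ℤ, ∑ v, x v = 0 ∧ ∑ v, x v • f v = a)
    (hker : ∀ x : V → ℤ, ∑ v, x v = 0 → ∑ v, x v • f v = 0 →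
      ∃ y, (G.lapMatrix ℤ).mulVec y = x) (s : V) :
    Nonempty (SandpileGroup G s ≃+ M) := by
  let φ : ({v : V // v ≠ s} → ℤ) →ₗ[ℤ] M :=
    Fintype.linearCombination ℤ fun v : {v : V // v ≠ s} => f v - f s
  have hφ (x : V → ℤ) (hx : ∑ v, x v = 0) : φ (fun v => x v) = ∑ v, x v • f v := by
    have h : ∑ v, x v • f v = ∑ v, x v • (f v - f s) := by
      simp [smul_sub, ← Finset.sum_smul, hx]
    rw [h, Fintype.sum_eq_add_sum_subtype_ne _ s, sub_self, smul_zero, zero_add]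
    rfl
  have hker' : LinearMap.range (reducedLaplacian G s).mulVecLin = LinearMap.ker φ := by
    ext x
    constructor
    · rintro ⟨y, rfl⟩
      let y' : V → ℤ := fun v => if h : v ≠ s then y ⟨v, h⟩ else 0
      have hy : (fun w : {v : V // v ≠ s} => y' w) = y := by
        ext w
        simp [y', w.2]
      have hL : (reducedLaplacian G s).mulVecLin y
          = fun v : {v : V // v ≠ s} => (G.lapMatrix ℤ).mulVec y' v := by
        ext v
        rw [← reducedLaplacian_mulVec G s y' (by simp [y']) v, hy]
        rfl
      rw [LinearMap.mem_ker, hL, hφ _ (G.sum_lapMatrix_mulVec y'), G.sum_lapMatrix_mulVec_smul]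
      exact Finset.sum_eq_zero fun v _ => by rw [hf v, smul_zero]
    · intro hx
      -- The value at the sink is chosen to make the total weight zero.
      let x' : V → ℤ := fun v => if h : v ≠ s then x ⟨v, h⟩ else -∑ w, x w
      have hxx : (fun w : {v : V // v ≠ s} => x' w) = x := by
        ext w
        simp [x', w.2]
      have hsum : ∑ v, x' v = 0 := by
        rw [Fintype.sum_eq_add_sum_subtype_ne _ s, hxx]
        simp [x']
      obtain ⟨y, hy⟩ := hker x' hsum (by rw [← hφ x' hsum, hxx]; exact hx)
      -- Constants lie in the kernel of the Laplacian, so `y` may be shifted to vanish at the sink.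
      refine ⟨fun w => y w - y s, ?_⟩
      ext v
      have h1 := reducedLaplacian_mulVec G s (fun w => y w - y s) (by simp) v
      have h2 : (fun w => y w - y s) = y - y s • fun _ => (1 : ℤ) := by
        ext w
        simp
      rw [Matrix.mulVecLin_apply, h1, h2, Matrix.mulVec_sub, Matrix.mulVec_smul,
        G.lapMatrix_mulVec_const_eq_zero, smul_zero, sub_zero, hy]
      exact congrFun hxx v
  have hs : Function.Surjective φ := fun a => by
    obtain ⟨x, hx, rfl⟩ := hsurj a
    exact ⟨_, hφ x hx⟩
  exact ⟨((Submodule.quotEquivOfEq _ _ hker').trans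
    (φ.quotKerEquivOfSurjective hs)).toAddEquiv⟩

/-- A harmonic function vanishing at a vertex `u`, with values generating `M`, from which the
classes modulo the image of the Laplacian can be recovered, identifies every sandpile group of `G`
with `M`. -/
theorem SimpleGraph.IsHarmonic.nonempty_sandpileGroup_addEquiv_of_hom {G : SimpleGraph V}
    [DecidableRel G.Adj] {f : V → M} (hf : G.IsHarmonic f) (u : V) (hu : f u = 0)
    (hspan : Submodule.span ℤ (Set.range f) = ⊤)
    (ψ : M →+ (V → ℤ) ⧸ LinearMap.range (G.lapMatrix ℤ).mulVecLin)
    (hψ : ∀ v, ψ (f v) = (LinearMap.range (G.lapMatrix ℤ).mulVecLin).mkQ (Pi.single v 1)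
      - (LinearMap.range (G.lapMatrix ℤ).mulVecLin).mkQ (Pi.single u 1)) (s : V) :
    Nonempty (SandpileGroup G s ≃+ M) := by
  refine hf.nonempty_sandpileGroup_addEquiv (fun a => ?_) (fun x hx hxf => ?_) s
  · have ha : a ∈ Submodule.span ℤ (Set.range f) := hspan ▸ Submodule.mem_top
    obtain ⟨x, rfl⟩ := (Submodule.mem_span_range_iff_exists_fun ℤ).1 ha
    -- Since `f u = 0`, the weight can be corrected at `u` without changing the combination.
    refine ⟨x - Pi.single u (∑ v, x v), ?_, ?_⟩
    · simp
    · simp only [Pi.sub_apply, sub_smul, Finset.sum_sub_distrib]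
      rw [sub_eq_self]
      refine Finset.sum_eq_zero fun v _ => ?_
      by_cases h : v = u
      · rw [h, hu, smul_zero]
      · simp [h]
  · have h := congrArg ψ hxf
    simp only [map_sum, map_zsmul, hψ, smul_sub, Finset.sum_sub_distrib, ← Finset.sum_smul, hx,
      zero_smul, sub_zero, map_zero] at h
    simp only [← map_zsmul, ← map_sum] at h
    have hx' : ∑ v, x v • (Pi.single v 1 : V → ℤ) = x := (pi_eq_sum_univ' x).symm
    rw [hx'] at h
    exact (Submodule.Quotient.mk_eq_zero _).1 h

end Sandpile

/-! ### Harmonic functions on the book graph -/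

section Book

variable {n k : ℕ}

/-- The vertices of the `i`-th page along the path from one end of the spine to the other. -/
def bookPath (n : ℕ) {k : ℕ} (i : Fin k) : ℕ → BookVertex n k
  | 0 => Sum.inl false
  | j + 1 => if h : j < n - 2 then Sum.inr (i, ⟨j, h⟩) else Sum.inl true

theorem bookGraph_adj (u v : BookVertex n k) :
    (bookGraph n k).Adj u v ↔ u ≠ v ∧ (bookRel n k u v ∨ bookRel n k v u) := Iff.rfl

theorem bookPath_succ_of_lt (i : Fin k) {j : ℕ} (h : j < n - 2) :
    bookPath n i (j + 1) = Sum.inr (i, ⟨j, h⟩) := dif_pos h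

theorem bookPath_last (hn : 3 ≤ n) (i : Fin k) : bookPath n i (n - 1) = Sum.inl true := by
  obtain ⟨q, rfl⟩ := Nat.exists_eq_add_of_le' hn
  exact dif_neg (by omega)

theorem bookGraph_sum_neighborFinset_page {M : Type*} [AddCommMonoid M] (F : BookVertex n k → M)
    (i : Fin k) (j : Fin (n - 2)) :
    ∑ w ∈ (bookGraph n k).neighborFinset (Sum.inr (i, j)), F w
      = F (bookPath n i j) + F (bookPath n i (j + 2)) := by
  obtain ⟨j, hj⟩ := j
  have hne : bookPath n i j ≠ bookPath n i (j + 2) := by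
    rcases j with _ | j
    · simp only [bookPath]
      split_ifs <;> simp
    · simp only [bookPath]
      split_ifs <;> simp <;> omega
  rw [← Finset.sum_pair hne]
  congr 1
  ext w
  rw [SimpleGraph.mem_neighborFinset, bookGraph_adj, Finset.mem_insert, Finset.mem_singleton]
  rcases w with b | ⟨i', j', hj'⟩
  · rcases j with _ | j <;> simp only [bookPath, bookRel] <;> split_ifs <;> simp <;> grind
  · rcases j with _ | j <;> simp only [bookPath, bookRel] <;> split_ifs <;> simp <;> grind

theorem bookGraph_sum_neighborFinset_false {M : Type*} [AddCommMonoid M] (hn : 3 ≤ n)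
    (F : BookVertex n k → M) :
    ∑ w ∈ (bookGraph n k).neighborFinset (Sum.inl false), F w
      = F (Sum.inl true) + ∑ i, F (bookPath n i 1) := by
  have h (w) : (bookGraph n k).Adj (Sum.inl false) w ↔
      w = Sum.inl true ∨ ∃ i, w = bookPath n i 1 := by
    rw [bookGraph_adj]
    have h0 : 0 < n - 2 := by omega
    rcases w with b | ⟨i, j, hj⟩ <;> simp [bookPath, bookRel, h0]
  have hN : (bookGraph n k).neighborFinset (Sum.inl false)
      = insert (Sum.inl true) (Finset.univ.image fun i => bookPath n i 1) := by
    ext w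
    simp [h, eq_comm]
  have h0 : 0 < n - 2 := by omega
  rw [hN, Finset.sum_insert, Finset.sum_image]
  · intro i _ i' _
    simp [bookPath, h0]
  · simp [bookPath, h0]

theorem bookGraph_sum_neighborFinset_true {M : Type*} [AddCommMonoid M] (hn : 3 ≤ n)
    (F : BookVertex n k → M) :
    ∑ w ∈ (bookGraph n k).neighborFinset (Sum.inl true), F w
      = F (Sum.inl false) + ∑ i, F (bookPath n i (n - 2)) := by
  obtain ⟨q, rfl⟩ := Nat.exists_eq_add_of_le' hn
  have hp (i : Fin k) : bookPath (q + 3) i (q + 3 - 2) = Sum.inr (i, ⟨q, by omega⟩) :=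
    bookPath_succ_of_lt i _
  have h (w) : (bookGraph (q + 3) k).Adj (Sum.inl true) w ↔
      w = Sum.inl false ∨ ∃ i, w = bookPath (q + 3) i (q + 3 - 2) := by
    rw [bookGraph_adj]
    simp only [hp]
    rcases w with b | ⟨i, j, hj⟩ <;> simp [bookRel]
  have hN : (bookGraph (q + 3) k).neighborFinset (Sum.inl true)
      = insert (Sum.inl false) (Finset.univ.image fun i => bookPath (q + 3) i (q + 3 - 2)) := by
    ext w
    simp [h, eq_comm]
  rw [hN, Finset.sum_insert, Finset.sum_image]
  · intro i _ i' _
    simp only [hp]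
    simp
  · simp only [hp]
    simp

variable {M : Type*} [AddCommGroup M]

/-- A harmonic function is an arithmetic progression along each page. -/
theorem bookGraph_isHarmonic_bookPath {c : BookVertex n k → M}
    (hc : (bookGraph n k).IsHarmonic c) (i : Fin k) :
    ∀ j ≤ n - 1, c (bookPath n i j) - c (Sum.inl false)
      = j • (c (bookPath n i 1) - c (Sum.inl false))
  | 0, _ => by simp [bookPath]
  | 1, _ => by simp
  | j + 2, hj => by
    have h0 := bookGraph_isHarmonic_bookPath hc i j (by omega)
    have h1 := bookGraph_isHarmonic_bookPath hc i (j + 1) (by omega)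
    have h := hc (Sum.inr (i, ⟨j, by omega⟩))
    rw [bookGraph_sum_neighborFinset_page, ← bookPath_succ_of_lt] at h
    -- An inner vertex has two neighbours, so harmonicity there says that the second difference
    -- vanishes.
    have h' : c (bookPath n i (j + 2)) - c (Sum.inl false)
        = 2 • (c (bookPath n i (j + 1)) - c (Sum.inl false))
          - (c (bookPath n i j) - c (Sum.inl false)) := by
      rw [← sub_eq_zero, ← neg_eq_zero, ← h]
      abel
    rw [h', h0, h1]
    module

/-- The sum of the slopes of a harmonic function on the pages. -/
theorem bookGraph_isHarmonic_sum {c : BookVertex n k → M} (hn : 3 ≤ n)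
    (hc : (bookGraph n k).IsHarmonic c) :
    ∑ i, (c (bookPath n i 1) - c (Sum.inl false)) = c (Sum.inl false) - c (Sum.inl true) := by
  have h := hc (Sum.inl false)
  rw [bookGraph_sum_neighborFinset_false hn, add_eq_zero_iff_eq_neg, ← Finset.sum_neg_distrib] at h
  simpa using h.symm

/-- The function on the book graph with slope `g i` on the `i`-th page and value `t` at the far end
of the spine. -/
def bookFun (n : ℕ) {k : ℕ} (g : Fin k → M) (t : M) : BookVertex n k → M
  | Sum.inl false => 0
  | Sum.inl true => t
  | Sum.inr (i, j) => (j.val + 1) • g i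

theorem bookFun_bookPath (g : Fin k → M) (t : M) (hg : ∀ i, (n - 1) • g i = t) (i : Fin k) {j : ℕ}
    (hj : j ≤ n - 1) : bookFun n g t (bookPath n i j) = j • g i := by
  rcases j with _ | j
  · simp [bookPath, bookFun]
  · simp only [bookPath]
    split_ifs with h
    · rfl
    · rw [show j + 1 = n - 1 by omega, hg]
      rfl

theorem bookFun_isHarmonic (hn : 3 ≤ n) (g : Fin k → M) (t : M) (hg : ∀ i, (n - 1) • g i = t)
    (ht : ∑ i, g i = -t) : (bookGraph n k).IsHarmonic (bookFun n g t) := by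
  rintro ((_ | _) | ⟨i, j⟩)
  · rw [bookGraph_sum_neighborFinset_false hn]
    simp only [bookFun_bookPath g t hg _ (show 1 ≤ n - 1 by omega)]
    simp [bookFun, ht]
  · rw [bookGraph_sum_neighborFinset_true hn]
    simp only [bookFun_bookPath g t hg _ (show n - 2 ≤ n - 1 by omega)]
    have h (i : Fin k) : bookFun n g t (Sum.inl true) - (n - 2) • g i = g i := by
      rw [show bookFun n g t (Sum.inl true) = t from rfl, ← hg i,
        show n - 1 = n - 2 + 1 by omega, succ_nsmul]
      abel
    simp only [h, ht]
    simp [bookFun]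
  · rw [bookGraph_sum_neighborFinset_page,
      bookFun_bookPath g t hg i (show (j : ℕ) ≤ n - 1 by omega),
      bookFun_bookPath g t hg i (show (j : ℕ) + 2 ≤ n - 1 by omega)]
    simp only [bookFun]
    module

end Book

/-! ### The group presented by the slopes -/

section Slopes

/-- The slopes of the universal harmonic function on the book graph with `r + 2` pages. -/
def bookSlope (r m N : ℕ) : Fin (r + 2) → (Fin r → ZMod m) × ZMod N :=
  Fin.cons (0, 1) (Fin.cons (-1, 1 - (m + r + 2)) fun j => (Pi.single j 1, 1))

variable (r m N : ℕ)

/-- The slope of page 1 is defined as what this relation forces once the others are fixed. -/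
theorem sum_bookSlope : ∑ i, bookSlope r m N i = -(0, (m : ZMod N)) := by
  have h : ∑ j : Fin r, ((Pi.single j 1 : Fin r → ZMod m), (1 : ZMod N)) = (1, (r : ZMod N)) := by
    ext j
    · simp [Prod.fst_sum, Finset.sum_apply, Pi.single_apply]
    · simp [Prod.snd_sum]
  rw [Fin.sum_univ_succ, Fin.sum_univ_succ]
  simp only [bookSlope, Fin.cons_zero, Fin.cons_succ, h]
  ext
  · simp
  · simp
    ring

theorem nsmul_bookSlope (hN : N = m * (m + r + 2)) (i : Fin (r + 2)) :
    m • bookSlope r m N i = (0, (m : ZMod N)) := by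
  have h0 : (m : ZMod N) * (m + r + 2) = 0 := by
    have := ZMod.natCast_self N
    rw [hN] at this ⊢
    exact_mod_cast this
  have hm (a : Fin r → ZMod m) : m • a = 0 := by
    ext j
    simp
  refine Fin.cases ?_ (fun i => Fin.cases ?_ (fun j => ?_) i) i
  · simp [bookSlope]
  · simp [bookSlope, hm, mul_sub, h0]
  · simp [bookSlope, hm]

/-- Slope 0 generates the cyclic factor; subtracting it from slope `j + 2` leaves the `j`-th basis
vector. -/
theorem span_range_bookSlope : Submodule.span ℤ (Set.range (bookSlope r m N)) = ⊤ := by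
  set S := Submodule.span ℤ (Set.range (bookSlope r m N)) with hS
  have hmem (i) : bookSlope r m N i ∈ S := Submodule.subset_span ⟨i, rfl⟩
  have h0 : ((0 : Fin r → ZMod m), (1 : ZMod N)) ∈ S := hmem 0
  have h1 (j : Fin r) : ((Pi.single j 1 : Fin r → ZMod m), (0 : ZMod N)) ∈ S := by
    simpa [bookSlope] using S.sub_mem (hmem j.succ.succ) h0
  rw [eq_top_iff]
  rintro ⟨a, b⟩ -
  obtain ⟨b, rfl⟩ := ZMod.intCast_surjective b
  choose a' ha' using fun j => ZMod.intCast_surjective (a j)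
  have h : (a, (b : ZMod N)) = ∑ j, a' j • ((Pi.single j 1 : Fin r → ZMod m), (0 : ZMod N))
      + b • ((0 : Fin r → ZMod m), (1 : ZMod N)) := by
    ext j
    · simp [Prod.fst_sum, Finset.sum_apply, Pi.single_apply, ha']
    · simp [Prod.snd_sum]
  rw [h]
  exact S.add_mem (S.sum_mem fun j _ => S.smul_mem _ (h1 j)) (S.smul_mem _ h0)

/-- The slopes `bookSlope` are universal among families with the same relations. -/
theorem exists_hom_bookSlope {Q : Type*} [AddCommGroup Q] (hN : N = m * (m + r + 2))
    (γ : Fin (r + 2) → Q) (t : Q) (hγ : ∀ i, m • γ i = t) (hsum : ∑ i, γ i = -t) :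
    ∃ ψ : (Fin r → ZMod m) × ZMod N →+ Q, ∀ i, ψ (bookSlope r m N i) = γ i := by
  have hsum' : γ 0 + (γ 1 + ∑ j : Fin r, γ j.succ.succ) = -t := by
    rw [← hsum, Fin.sum_univ_succ, Fin.sum_univ_succ]
    rfl
  have h0 : (N : ℤ) • γ 0 = 0 := by
    have h : (m + r + 2) • γ 0 = ∑ i, (γ 0 - γ i) := by
      rw [Finset.sum_sub_distrib, hsum, ← hγ 0]
      simp only [Finset.sum_const, Finset.card_univ, Fintype.card_fin]
      module
    rw [natCast_zsmul, hN, mul_nsmul', h, Finset.smul_sum]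
    simp [smul_sub, hγ]
  have h1 (j : Fin r) : (m : ℤ) • (γ j.succ.succ - γ 0) = 0 := by
    rw [natCast_zsmul, smul_sub, hγ, hγ, sub_self]
  let α (j : Fin r) : ZMod m →+ Q :=
    ZMod.lift m ⟨zmultiplesHom Q (γ j.succ.succ - γ 0), by simpa using h1 j⟩
  let β : ZMod N →+ Q := ZMod.lift N ⟨zmultiplesHom Q (γ 0), by simpa using h0⟩
  have hα (j : Fin r) : α j 1 = γ j.succ.succ - γ 0 := by
    have := ZMod.lift_coe m ⟨zmultiplesHom Q (γ j.succ.succ - γ 0), by simpa using h1 j⟩ 1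
    simpa using this
  have hβ (z : ℤ) : β z = z • γ 0 := ZMod.lift_coe N _ z
  have hβ1 : β 1 = γ 0 := by simpa using hβ 1
  refine ⟨(∑ j, (α j).comp (Pi.evalAddMonoidHom _ j)).coprod β, fun i => ?_⟩
  refine Fin.cases ?_ (fun i => Fin.cases ?_ (fun j => ?_) i) i
  · simp [bookSlope, hβ1]
  · have hz : (1 - (m + r + 2) : ZMod N) = ((1 - (m + r + 2) : ℤ) : ZMod N) := by push_cast; rfl
    -- The sum relation solved for `γ 1`, with `t` replaced by `m • γ 0`.
    have hs : γ 1 = -(m • γ 0) - γ 0 - ∑ j : Fin r, γ j.succ.succ := by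
      rw [hγ, ← hsum']
      abel
    have ht : (Fin.succ 0 : Fin (r + 2)) = 1 := rfl
    rw [ht, hs]
    simp only [bookSlope, ← ht, Fin.cons_succ, Fin.cons_zero, hz, AddMonoidHom.coprod_apply, hβ,
      AddMonoidHom.finsetSum_apply, AddMonoidHom.comp_apply, Pi.evalAddMonoidHom_apply,
      Pi.one_apply, map_neg, hα, Finset.sum_sub_distrib,
      Finset.sum_const, Finset.card_univ, Fintype.card_fin]
    module
  · simp only [bookSlope, Fin.cons_succ, AddMonoidHom.coprod_apply, hβ1,
      AddMonoidHom.finsetSum_apply, AddMonoidHom.comp_apply, Pi.evalAddMonoidHom_apply]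
    rw [Finset.sum_eq_single j]
    · simp [hα]
    · intro b _ hb
      simp [hb]
    · simp

end Slopes

/-! ### Sandpile group of the book -/

theorem bookGraph_sandpileGroup (q r N : ℕ) (hN : N = (q + 2) * (q + 2 + r + 2))
    (s : BookVertex (q + 3) (r + 2)) :
    Nonempty (SandpileGroup (bookGraph (q + 3) (r + 2)) s ≃+
      (Fin r → ZMod (q + 2)) × ZMod N) := by
  have hn : 3 ≤ q + 3 := by omega
  set g := bookSlope r (q + 2) N with hg
  set t : (Fin r → ZMod (q + 2)) × ZMod N := (0, ((q + 2 : ℕ) : ZMod N)) with ht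
  have hgt : ∀ i, (q + 3 - 1) • g i = t := nsmul_bookSlope r (q + 2) N hN
  set c : BookVertex (q + 3) (r + 2) → _ := fun v =>
    (LinearMap.range ((bookGraph (q + 3) (r + 2)).lapMatrix ℤ).mulVecLin).mkQ (Pi.single v 1)
    with hcdef
  have hc : (bookGraph (q + 3) (r + 2)).IsHarmonic c :=
    (bookGraph (q + 3) (r + 2)).isHarmonic_mk_single
  have hlin := bookGraph_isHarmonic_bookPath hc
  have hT (i : Fin (r + 2)) : (q + 2) • (c (bookPath (q + 3) i 1) - c (Sum.inl false))
      = c (Sum.inl true) - c (Sum.inl false) := by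
    rw [← bookPath_last hn i]
    exact (hlin i (q + 2) le_rfl).symm
  obtain ⟨ψ, hψ⟩ := exists_hom_bookSlope r (q + 2) N hN _ _ hT
    (by rw [bookGraph_isHarmonic_sum hn hc, neg_sub])
  refine (bookFun_isHarmonic hn g t hgt (sum_bookSlope r (q + 2) N)
    ).nonempty_sandpileGroup_addEquiv_of_hom (Sum.inl false) rfl ?_ ψ ?_ s
  -- The slopes are the values at the first inner vertex of each page, so the values generate.
  · rw [eq_top_iff, ← span_range_bookSlope r (q + 2) N]
    refine Submodule.span_mono ?_
    rintro _ ⟨i, rfl⟩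
    exact ⟨Sum.inr (i, ⟨0, by omega⟩), by simp [bookFun, hg]⟩
  · have key (i : Fin (r + 2)) (j : ℕ) (hj : j ≤ q + 3 - 1) :
        ψ (bookFun (q + 3) g t (bookPath (q + 3) i j))
          = c (bookPath (q + 3) i j) - c (Sum.inl false) := by
      rw [bookFun_bookPath g t hgt i hj, map_nsmul, hψ, hlin i j hj]
    rintro ((_ | _) | ⟨i, j⟩)
    · exact key 0 0 (by omega)
    · have := key 0 (q + 3 - 1) le_rfl
      rwa [bookPath_last hn] at this
    · have := key i (j + 1) (by omega)
      rwa [bookPath_succ_of_lt i j.2] at this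

/-! ### Square pages: star times an edge -/

/-- The bijection between the vertices of the book with square pages and those of the product of a
star and an edge. -/
def squareBookEquiv (k : ℕ) : BookVertex 4 k ≃ Fin (k + 1) × Fin 2 where
  toFun
    | Sum.inl b => (0, if b then 1 else 0)
    | Sum.inr (i, j) => (i.succ, j)
  invFun p := Fin.cases (Sum.inl (p.2 == 1)) (fun i => Sum.inr (i, p.2)) p.1
  left_inv := by
    rintro ((_ | _) | ⟨i, j⟩) <;> simp
  right_inv := by
    rintro ⟨i, j⟩
    refine Fin.cases ?_ (fun i => ?_) i
    · fin_cases j <;> simp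
    · simp

theorem squareBook_iso (k : ℕ) : Nonempty (bookGraph 4 k ≃g
    (SimpleGraph.starGraph (0 : Fin (k + 1))).boxProd (SimpleGraph.pathGraph 2)) := by
  refine ⟨squareBookEquiv k, ?_⟩
  intro u v
  rw [SimpleGraph.boxProd_adj, bookGraph_adj, SimpleGraph.starGraph_adj,
    SimpleGraph.pathGraph_two_eq_top, SimpleGraph.top_adj]
  rcases u with (_ | _) | ⟨i, j⟩ <;> rcases v with (_ | _) | ⟨i', j'⟩ <;>
    try change Fin 2 at j
  all_goals try change Fin 2 at j'
  all_goals try fin_cases j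
  all_goals try fin_cases j'
  all_goals simp [squareBookEquiv, bookRel, eq_comm]

theorem mainTheorem4 (n k : ℕ) (hn : 3 ≤ n) (hk : 2 ≤ k) :
    (∀ s : BookVertex n k,
      Nonempty (SandpileGroup (bookGraph n k) s ≃+
        (Fin (k - 2) → ZMod (n - 1)) × ZMod ((n - 1) * (n + k - 1)))) ∧
    Nonempty (bookGraph 4 k ≃g
      (SimpleGraph.starGraph (0 : Fin (k + 1))).boxProd (SimpleGraph.pathGraph 2)) := by
  refine ⟨?_, squareBook_iso k⟩
  obtain ⟨q, rfl⟩ := Nat.exists_eq_add_of_le' hn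
  obtain ⟨r, rfl⟩ := Nat.exists_eq_add_of_le' hk
  refine bookGraph_sandpileGroup q r _ ?_
  rw [show q + 3 - 1 = q + 2 by omega, show q + 3 + (r + 2) - 1 = q + 2 + r + 2 by omega]
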